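/- Let $p>3$ be a prime, let $\left(\frac{\cdot}{p}\right)$ denote the Legendre symbol, and put $$H_n=\sum_{0<k\le n}\frac1k,\qquad H_n^{(2)}=\sum_{0<k\le n}\frac1{k^2}\qquad(n=0,1,2,\ldots).$$ Let $E_0,E_1,E_2,\ldots$ be the Euler numbers, given by $E_0=1$ and $\sum_{0\le k\le n,\ 2\mid k}\binom nk E_{n-k}=0$ for $n=1,2,3,\ldots$. For $m\ge1$ and rational numbers $x,y$ with denominators prime to $m$, write $x\equiv y\pmod m$ if $x-y=mz$ for some rational number $z$ with denominator prime to $m$. Then all sides of the following congruences are rational numbers with denominators prime to $p$, and $$\sum_{k=0}^{(p-1)/2}\binom{2k}k^2\frac{H_k}{16^k}\equiv 2\left(\frac{-1}p\right)H_{(p-1)/2}\pmod{p^2},$$ $$\sum_{k=1}^{(p-1)/2}\binom{2k}k^2\frac{H_k^{(2)}}{16^k}\equiv -4E_{p-3}\pmod p,$$ $$\sum_{k=1}^{(p-1)/2}\binom{2k}k^2\frac{H_k}{k\,16^k}\equiv 4\left(\frac{-1}p\right)E_{p-3}\pmod p,$$ $$\sum_{k=0}^{(p-1)/2}\binom{2k}k^2\frac{H_{2k}}{16^k}\equiv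 \left(\frac{-1}p\right)\frac32H_{(p-1)/2}+pE_{p-3}\pmod{p^2}.$$ -/

import Mathlib

/-- The Euler numbers `E₀, E₁, E₂, …`: `E₀ = 1` and, for `n ≥ 1`,
`∑_{0 ≤ k ≤ n, 2 ∣ k} (n choose k) E_{n-k} = 0`. The recursion is solved here for the term `k = 0`,
with the sum indexed by `j = n - k`; see `eulerNumber_recursion`. -/
def eulerNumber : ℕ → ℤ
  | 0 => 1
  | n + 1 => -∑ j : Fin (n + 1),
      if 2 ∣ n + 1 - (j : ℕ) then ((n + 1).choose j : ℤ) * eulerNumber j else 0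

theorem eulerNumber_zero : eulerNumber 0 = 1 := by
  rw [eulerNumber]

theorem eulerNumber_recursion (n : ℕ) (hn : 1 ≤ n) :
    ∑ k ∈ (Finset.range (n + 1)).filter (fun k => 2 ∣ k),
      (n.choose k : ℤ) * eulerNumber (n - k) = 0 := by
  obtain ⟨m, rfl⟩ : ∃ m, n = m + 1 := ⟨n - 1, by omega⟩
  rw [Finset.sum_filter, ← Finset.sum_range_reflect, Finset.sum_range_succ]
  have h : eulerNumber (m + 1) = -∑ j ∈ Finset.range (m + 1),
      if 2 ∣ m + 1 - j then ((m + 1).choose j : ℤ) * eulerNumber j else 0 := by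
    rw [eulerNumber, Finset.sum_range]
  have h' : ∑ j ∈ Finset.range (m + 1),
      (if 2 ∣ m + 1 + 1 - 1 - j then ((m + 1).choose (m + 1 + 1 - 1 - j) : ℤ) *
        eulerNumber (m + 1 - (m + 1 + 1 - 1 - j)) else 0)
      = ∑ j ∈ Finset.range (m + 1),
      if 2 ∣ m + 1 - j then ((m + 1).choose j : ℤ) * eulerNumber j else 0 := by
    refine Finset.sum_congr rfl fun j hj => ?_
    have hj' : j ≤ m + 1 := by
      have := Finset.mem_range.1 hj
      omega
    rw [Nat.add_sub_cancel, Nat.choose_symm hj', Nat.sub_sub_self hj']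
  rw [h']
  simp [h]

/-- The harmonic numbers of the second order, `H_n^{(2)} = ∑_{0 < k ≤ n} 1 / k²`. -/
def harmonicSecond (n : ℕ) : ℚ := ∑ k ∈ Finset.Icc 1 n, 1 / (k : ℚ) ^ 2

/-- Congruence of rational numbers modulo a positive integer `m`: both sides have denominators
prime to `m`, and their difference is `m` times a rational number with denominator prime to `m`. -/
def RatModEq (m : ℕ) (x y : ℚ) : Prop :=
  x.den.Coprime m ∧ y.den.Coprime m ∧ ∃ z : ℚ, z.den.Coprime m ∧ x - y = (m : ℚ) * z

/-! Put n = (p-1)/2 and L(n,k) = (-1)^k C(n,k) C(n+k,k). Successive ratios of L(n,k) in k are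
(k(k+1) - n(n+1))/(k+1)², and k(k+1) - n(n+1) = (k+1/2)² - p²/4, while those of C(2k,k)²/16^k are
(k+1/2)²/(k+1)². Hence the two agree modulo p² for k ≤ n (`legendreCoeff_congrMod_centralTerm`), and
each sum becomes a sum against L(n,k).

Those sums have exact values for every n, found by induction on n: with A_s(n) = ∑_{0<k≤n}
(-1)^k/k^s, the weights H_k, H_k^{(2)}, H_k/k, H_{2k} give 2(-1)^n H_n, -2(-1)^n A_2(n), 2A_2(n),
(-1)^n (2H_n - A_1(n)).

It remains to reduce A_2 modulo p and A_1 modulo p². By Fermat, A_2(n) is an alternating sum of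
(p-3)-th powers, which telescopes through an Euler polynomial and gives 2(-1)^n E_{p-3}. Reflecting
k ↦ p-k in A_1(p-1) = H_n - H_{p-1} and applying Wolstenholme's theorem expresses A_1(n) through H_n
and p·A_2(n). -/

/-! ### Coefficients of shifted Legendre polynomials and their recurrences. -/

/-- The coefficient of `x ^ k` in the shifted Legendre polynomial `P_n(1 - 2 x)`. -/
def legendreCoeff (n k : ℕ) : ℚ := (-1) ^ k * n.choose k * (n + k).choose k

theorem legendreCoeff_zero_right (n : ℕ) : legendreCoeff n 0 = 1 := by simp [legendreCoeff]

theorem legendreCoeff_eq_zero {n k : ℕ} (h : n < k) : legendreCoeff n k = 0 := by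
  simp [legendreCoeff, Nat.choose_eq_zero_of_lt h]

theorem legendreCoeff_succ_right (n k : ℕ) :
    ((k : ℚ) + 1) ^ 2 * legendreCoeff n (k + 1) = (k * (k + 1) - n * (n + 1)) * legendreCoeff n k := by
  rcases lt_or_ge n k with h | h
  · rw [legendreCoeff_eq_zero h, legendreCoeff_eq_zero (by omega)]; simp
  · have h1 := congrArg (Nat.cast : ℕ → ℚ) (Nat.choose_succ_right_eq n k)
    have h2 := congrArg (Nat.cast : ℕ → ℚ) (Nat.add_one_mul_choose_eq (n + k) k)
    push_cast [Nat.cast_sub h] at h1 h2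
    simp only [legendreCoeff, pow_succ, ← add_assoc]
    linear_combination (-(-1 : ℚ) ^ k * ((n + k + 1).choose (k + 1)) * (k + 1)) * h1
      + ((-1 : ℚ) ^ k * (n.choose k) * (n - k)) * h2

theorem legendreCoeff_succ_left (n k : ℕ) :
    ((n : ℚ) + 1 - k) * legendreCoeff (n + 1) k = (n + 1 + k) * legendreCoeff n k := by
  rcases lt_or_ge (n + 1) k with h | h
  · rw [legendreCoeff_eq_zero h, legendreCoeff_eq_zero (by omega)]; simp
  · have h1 := congrArg (Nat.cast : ℕ → ℚ) (Nat.choose_mul_succ_eq n k)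
    have h2 := congrArg (Nat.cast : ℕ → ℚ) (Nat.choose_mul_succ_eq (n + k) k)
    rw [show n + k + 1 - k = n + 1 by omega] at h2
    push_cast [Nat.cast_sub h] at h1 h2
    simp only [legendreCoeff, show n + 1 + k = n + k + 1 by omega]
    have h0 : (n : ℚ) + 1 ≠ 0 := by positivity
    apply mul_left_cancel₀ h0
    linear_combination (-(-1 : ℚ) ^ k * ((n + k + 1).choose k) * (n + 1)) * h1
      - ((-1 : ℚ) ^ k * (n.choose k) * (n + 1)) * h2

/-- The mean of consecutive coefficients, normalised to be a common factor of both. -/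
def legendreMean (n k : ℕ) : ℚ := (legendreCoeff (n + 1) k + legendreCoeff n k) / (2 * (n + 1))

/-- The common factor is morally L(n,k)/(n+1-k), which is 0/0 at k = n+1; the mean gives the right
value there too. -/
theorem legendreCoeff_succ_eq_mean (n k : ℕ) :
    legendreCoeff (n + 1) k = (n + 1 + k) * legendreMean n k := by
  have h0 : (n : ℚ) + 1 ≠ 0 := by positivity
  rw [legendreMean]; field_simp
  linear_combination legendreCoeff_succ_left n k

theorem legendreCoeff_eq_mean (n k : ℕ) :
    legendreCoeff n k = (n + 1 - k) * legendreMean n k := by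
  have h0 : (n : ℚ) + 1 ≠ 0 := by positivity
  rw [legendreMean]; field_simp
  linear_combination -legendreCoeff_succ_left n k

theorem legendreMean_succ (n k : ℕ) :
    ((k : ℚ) + 1) ^ 2 * legendreMean n (k + 1) = -(n + 1 + k) * legendreCoeff n k := by
  have h0 : (n : ℚ) + 1 ≠ 0 := by positivity
  have h1 := legendreCoeff_succ_right (n + 1) k
  have h2 := legendreCoeff_succ_right n k
  rw [legendreCoeff_succ_eq_mean n k] at h1
  rw [legendreCoeff_eq_mean n k] at h2 ⊢
  push_cast at h1
  rw [legendreMean]; field_simp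
  linear_combination h1 + h2

theorem legendreMean_eq_zero {n k : ℕ} (h : n + 1 < k) : legendreMean n k = 0 := by
  simp [legendreMean, legendreCoeff_eq_zero h, legendreCoeff_eq_zero (show n < k by omega)]

/-! ### Summation by parts and rational weights. -/

/-- Summation of `f` against the coefficients of the shifted Legendre polynomial. -/
def legendreSum (n : ℕ) (f : ℕ → ℚ) : ℚ := ∑ k ∈ Finset.range (n + 1), legendreCoeff n k * f k

theorem legendreSum_eq_sum_range {n N : ℕ} (h : n < N) (f : ℕ → ℚ) :
    legendreSum n f = ∑ k ∈ Finset.range N, legendreCoeff n k * f k := by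
  refine Finset.sum_subset (Finset.range_subset_range.2 h) fun k _ hk => ?_
  rw [legendreCoeff_eq_zero (by simpa using hk), zero_mul]

theorem legendreSum_add (n : ℕ) (f g : ℕ → ℚ) :
    legendreSum n (fun k => f k + g k) = legendreSum n f + legendreSum n g := by
  simp [legendreSum, mul_add, Finset.sum_add_distrib]

theorem legendreSum_mul (n : ℕ) (c : ℚ) (f : ℕ → ℚ) :
    legendreSum n (fun k => c * f k) = c * legendreSum n f := by
  simp only [legendreSum, Finset.mul_sum]
  exact Finset.sum_congr rfl fun k _ => by ring

theorem legendreSum_zero_left (f : ℕ → ℚ) : legendreSum 0 f = f 0 := by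
  simp [legendreSum, legendreCoeff_zero_right]

/-- Abel summation: writing M_k for `legendreMean n k`, (n+1)² M_k = k² M_k - (k+1)² M_{k+1}, and
L(n+1,k) + L(n,k) = 2(n+1) M_k. This drives the inductions on n: only the difference of f enters. -/
theorem legendreSum_succ_add (n : ℕ) (f : ℕ → ℚ) :
    legendreSum (n + 1) f + legendreSum n f
      = -2 / (n + 1) * legendreSum n (fun k => (n + 1 + k) * (f (k + 1) - f k)) := by
  have h0 : (n : ℚ) + 1 ≠ 0 := by positivity
  have key : ∀ N : ℕ, ∑ k ∈ Finset.range N, (n + 1) * legendreMean n k * f k =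
      -(∑ k ∈ Finset.range N, legendreCoeff n k * ((n + 1 + k) * (f (k + 1) - f k))) / (n + 1)
      - (N : ℚ) ^ 2 * legendreMean n N * f N / (n + 1) := by
    intro N
    induction N with
    | zero => simp
    | succ N ih =>
      rw [Finset.sum_range_succ, Finset.sum_range_succ, ih]
      have h1 := legendreMean_succ n N
      rw [Nat.cast_add_one, h1, legendreCoeff_eq_mean n N]
      field_simp
      ring
  -- At N = n+2 the boundary term vanishes.
  have h2 := key (n + 2)
  rw [legendreMean_eq_zero (show n + 1 < n + 2 by omega)] at h2
  rw [legendreSum_eq_sum_range (show n + 1 < n + 2 by omega) f,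
    legendreSum_eq_sum_range (show n < n + 2 by omega) f,
    legendreSum_eq_sum_range (show n < n + 2 by omega), ← Finset.sum_add_distrib]
  have h3 : ∀ k ∈ Finset.range (n + 2), legendreCoeff (n + 1) k * f k + legendreCoeff n k * f k
      = 2 * ((n + 1) * legendreMean n k * f k) := by
    intro k _
    rw [legendreCoeff_eq_mean n k, legendreCoeff_succ_eq_mean n k]; ring
  rw [Finset.sum_congr rfl h3, ← Finset.mul_sum, h2]
  ring

/-- The recurrence in k, multiplied by f and reindexed. The truncated value f(0 - 1) is harmless
because of the factor k². -/
theorem legendreSum_shift (n : ℕ) (f : ℕ → ℚ) :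
    legendreSum n (fun k => (k * (k + 1) - n * (n + 1)) * f k)
      = legendreSum n (fun k => (k : ℚ) ^ 2 * f (k - 1)) := by
  rw [legendreSum_eq_sum_range (show n < n + 2 by omega) (fun k => (k : ℚ) ^ 2 * f (k - 1)),
    Finset.sum_range_succ', legendreSum]
  simp only [Nat.cast_zero, Nat.add_sub_cancel, Nat.cast_add, Nat.cast_one]
  rw [zero_pow two_ne_zero, zero_mul, mul_zero, add_zero]
  refine Finset.sum_congr rfl fun k _ => ?_
  linear_combination (-f k) * legendreCoeff_succ_right n k

theorem legendreSum_one (n : ℕ) : legendreSum n (fun _ => 1) = (-1) ^ n := by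
  induction n with
  | zero => simp [legendreSum_zero_left]
  | succ n ih =>
    have h := legendreSum_succ_add n (fun _ => 1)
    have h1 : legendreSum n (fun k => (n + 1 + k) * ((1 : ℚ) - 1)) = 0 := by simp [legendreSum]
    rw [h1, ih] at h
    rw [pow_succ]; linear_combination h

/-- This is orthogonality of P_n to constants. The factor n is needed because the sum is 1 at n = 0.
-/
theorem mul_legendreSum_inv_succ (n : ℕ) :
    (n : ℚ) * legendreSum n (fun k => 1 / ((k : ℚ) + 1)) = 0 := by
  have h0 : (n : ℚ) + 1 ≠ 0 := by positivity
  have h := legendreSum_shift n (fun k => 1 / ((k : ℚ) + 1))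
  have h1 : legendreSum n (fun k => (k * (k + 1) - n * (n + 1)) * (1 / ((k : ℚ) + 1)))
      = legendreSum n (fun k => (k : ℚ) + (-(n * (n + 1)) : ℚ) * (1 / ((k : ℚ) + 1))) := by
    congr 1; ext k; field_simp; ring
  have h2 : legendreSum n (fun k => (k : ℚ) ^ 2 * (1 / (((k - 1 : ℕ) : ℚ) + 1)))
      = legendreSum n (fun k => (k : ℚ)) := by
    congr 1; ext k
    rcases k with _ | k
    · simp
    · simp only [Nat.add_sub_cancel]; push_cast; field_simp
  rw [h1, h2, legendreSum_add, legendreSum_mul] at h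
  apply mul_left_cancel₀ h0
  linear_combination -h

theorem legendreSum_inv_succ_sq (n : ℕ) :
    legendreSum n (fun k => (n + 1 + k) * (1 / ((k : ℚ) + 1) ^ 2)) = 1 / (n + 1) := by
  have h0 : (n : ℚ) + 1 ≠ 0 := by positivity
  have h := legendreSum_shift n (fun k => 1 / ((k : ℚ) + 1) ^ 2)
  have h1 : legendreSum n (fun k => (k * (k + 1) - n * (n + 1)) * (1 / ((k : ℚ) + 1) ^ 2))
      = legendreSum n (fun k => 1 + ((-1 : ℚ) * (1 / ((k : ℚ) + 1))
        + (-(n * (n + 1)) : ℚ) * (1 / ((k : ℚ) + 1) ^ 2))) := by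
    congr 1; ext k; field_simp; ring
  -- The weight is 1 for k ≥ 1 but 0 at k = 0, hence the correction -1.
  have h2 : legendreSum n (fun k => (k : ℚ) ^ 2 * (1 / (((k - 1 : ℕ) : ℚ) + 1) ^ 2))
      = legendreSum n (fun _ => 1) - 1 := by
    rw [legendreSum, legendreSum, Finset.sum_range_succ', Finset.sum_range_succ' (n := n)]
    simp only [legendreCoeff_zero_right]
    rw [mul_one, add_sub_cancel_right]
    simp only [Nat.add_sub_cancel, Nat.cast_add, Nat.cast_one, Nat.cast_zero]
    rw [zero_pow two_ne_zero, zero_mul, mul_zero, add_zero]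
    refine Finset.sum_congr rfl fun k _ => ?_
    field_simp
  rw [h1, h2, legendreSum_add, legendreSum_add, legendreSum_mul, legendreSum_mul] at h
  have h3 : legendreSum n (fun k => (n + 1 + k) * (1 / ((k : ℚ) + 1) ^ 2))
      = legendreSum n (fun k => 1 / ((k : ℚ) + 1) + (n : ℚ) * (1 / ((k : ℚ) + 1) ^ 2)) := by
    congr 1; ext k; field_simp; ring
  rw [h3, legendreSum_add, legendreSum_mul]
  field_simp
  linear_combination -h + mul_legendreSum_inv_succ n

/-- The left side is constant in n: (2n+3)(n+1+k) - (2n+1)(n+1-k) = 2(n+1)(2k+1) cancels the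
denominator, leaving (-1)^{n+1} + (-1)^n = 0. -/
theorem legendreSum_inv_odd (n : ℕ) :
    (2 * (n : ℚ) + 1) * legendreSum n (fun k => 1 / (2 * (k : ℚ) + 1)) = 1 := by
  induction n with
  | zero => simp [legendreSum_zero_left]
  | succ n ih =>
    have h : (2 * ((n : ℚ) + 1) + 1) * legendreSum (n + 1) (fun k => 1 / (2 * (k : ℚ) + 1))
        - (2 * (n : ℚ) + 1) * legendreSum n (fun k => 1 / (2 * (k : ℚ) + 1))
        = legendreSum (n + 1) (fun _ => 1) + legendreSum n (fun _ => 1) := by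
      rw [legendreSum_eq_sum_range (show n < n + 1 + 1 by omega) (fun k => 1 / (2 * (k : ℚ) + 1)),
        legendreSum_eq_sum_range (show n < n + 1 + 1 by omega) (fun _ => 1), legendreSum, legendreSum,
        Finset.mul_sum, Finset.mul_sum, ← Finset.sum_sub_distrib, ← Finset.sum_add_distrib]
      refine Finset.sum_congr rfl fun k _ => ?_
      rw [legendreCoeff_eq_mean n k, legendreCoeff_succ_eq_mean n k]
      field_simp
      ring
    rw [legendreSum_one, legendreSum_one, ih, pow_succ] at h
    push_cast
    linear_combination h

/-! ### Exact evaluation of the harmonic sums. -/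

theorem harmonicSecond_succ (n : ℕ) :
    harmonicSecond (n + 1) = harmonicSecond n + 1 / ((n : ℚ) + 1) ^ 2 := by
  rw [harmonicSecond, harmonicSecond, Finset.sum_Icc_succ_top (by omega)]
  push_cast; rfl

theorem legendreSum_succ_add_harmonic (n : ℕ) :
    legendreSum (n + 1) harmonic + legendreSum n harmonic = -2 * (-1) ^ n / (n + 1) := by
  have h0 : (n : ℚ) + 1 ≠ 0 := by positivity
  rw [legendreSum_succ_add]
  have h : legendreSum n (fun k => (n + 1 + k) * (harmonic (k + 1) - harmonic k))
      = legendreSum n (fun k => 1 + (n : ℚ) * (1 / ((k : ℚ) + 1))) := by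
    congr 1; ext k; rw [harmonic_succ]; push_cast; field_simp; ring
  rw [h, legendreSum_add, legendreSum_mul, legendreSum_one, mul_legendreSum_inv_succ]
  ring

theorem legendreSum_harmonic (n : ℕ) :
    legendreSum n harmonic = 2 * (-1) ^ n * harmonic n := by
  induction n with
  | zero => simp [legendreSum_zero_left]
  | succ n ih =>
    have h0 : (n : ℚ) + 1 ≠ 0 := by positivity
    have h := legendreSum_succ_add_harmonic n
    rw [ih] at h
    rw [harmonic_succ, pow_succ]
    push_cast
    linear_combination h

/-- The alternating power sum `∑_{0 < k ≤ n} (-1)^k / k^s`. -/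
def alternatingHarmonic (s n : ℕ) : ℚ := ∑ k ∈ Finset.range n, (-1) ^ (k + 1) / ((k : ℚ) + 1) ^ s

theorem alternatingHarmonic_succ (s n : ℕ) :
    alternatingHarmonic s (n + 1) = alternatingHarmonic s n + (-1) ^ (n + 1) / ((n : ℚ) + 1) ^ s :=
  Finset.sum_range_succ _ _

theorem neg_one_pow_mul_self (n : ℕ) : (-1 : ℚ) ^ n * (-1) ^ n = 1 := by
  rw [← mul_pow]; simp

theorem legendreSum_harmonicSecond (n : ℕ) :
    legendreSum n harmonicSecond = -2 * (-1) ^ n * alternatingHarmonic 2 n := by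
  induction n with
  | zero => simp [legendreSum_zero_left, harmonicSecond, alternatingHarmonic]
  | succ n ih =>
    have h0 : (n : ℚ) + 1 ≠ 0 := by positivity
    have h := legendreSum_succ_add n harmonicSecond
    have h1 : legendreSum n (fun k => (n + 1 + k) * (harmonicSecond (k + 1) - harmonicSecond k))
        = legendreSum n (fun k => (n + 1 + k) * (1 / ((k : ℚ) + 1) ^ 2)) := by
      congr 1; ext k; rw [harmonicSecond_succ]; ring
    rw [ih, h1, legendreSum_inv_succ_sq] at h
    rw [alternatingHarmonic_succ, pow_succ]
    field_simp at h ⊢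
    linear_combination h + 2 * neg_one_pow_mul_self n

/-- The difference in n is used here instead of the sum: L(n+1,k) - L(n,k) = 2k M_k absorbs the 1/k
and leaves the recurrence for the weight H_k. -/
theorem legendreSum_harmonic_div (n : ℕ) :
    legendreSum n (fun k => harmonic k / k) = 2 * alternatingHarmonic 2 n := by
  induction n with
  | zero => simp [legendreSum_zero_left, alternatingHarmonic]
  | succ n ih =>
    have h0 : (n : ℚ) + 1 ≠ 0 := by positivity
    have h : ((n : ℚ) + 1) * (legendreSum (n + 1) (fun k => harmonic k / k)
        - legendreSum n (fun k => harmonic k / k))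
        = legendreSum (n + 1) harmonic + legendreSum n harmonic := by
      rw [legendreSum_eq_sum_range (show n < n + 1 + 1 by omega) (fun k => harmonic k / k),
        legendreSum_eq_sum_range (show n < n + 1 + 1 by omega) harmonic, legendreSum, legendreSum,
        ← Finset.sum_sub_distrib, ← Finset.sum_add_distrib, Finset.mul_sum]
      refine Finset.sum_congr rfl fun k _ => ?_
      rw [legendreCoeff_eq_mean n k, legendreCoeff_succ_eq_mean n k]
      rcases k with _ | k
      · simp
      · push_cast; field_simp; ring
    rw [legendreSum_succ_add_harmonic, ih] at h
    rw [alternatingHarmonic_succ, pow_succ]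
    field_simp at h ⊢
    linear_combination h

theorem legendreSum_harmonic_two_mul (n : ℕ) :
    legendreSum n (fun k => harmonic (2 * k))
      = (-1) ^ n * (2 * harmonic n - alternatingHarmonic 1 n) := by
  induction n with
  | zero => simp [legendreSum_zero_left, alternatingHarmonic]
  | succ n ih =>
    have h0 : (n : ℚ) + 1 ≠ 0 := by positivity
    have h := legendreSum_succ_add n (fun k => harmonic (2 * k))
    have h1 : legendreSum n (fun k => (n + 1 + k) * (harmonic (2 * (k + 1)) - harmonic (2 * k)))
        = legendreSum n (fun k => 1 + ((1 / 2 : ℚ) * (n * (1 / ((k : ℚ) + 1)))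
          + ((2 * (n : ℚ) + 1) / 2) * (1 / (2 * (k : ℚ) + 1)))) := by
      congr 1; ext k
      rw [show 2 * (k + 1) = 2 * k + 1 + 1 by ring, harmonic_succ, harmonic_succ]
      push_cast
      rw [show 2 * (k : ℚ) + 1 + 1 = 2 * (k + 1) by ring]
      field_simp
      ring
    rw [h1, legendreSum_add, legendreSum_add, legendreSum_mul, legendreSum_mul, legendreSum_mul,
      legendreSum_one, ih, mul_legendreSum_inv_succ] at h
    have h2 := legendreSum_inv_odd n
    rw [alternatingHarmonic_succ, pow_succ, harmonic_succ]
    push_cast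
    field_simp at h ⊢
    linear_combination h - h2 + neg_one_pow_mul_self n

/-! ### Euler numbers, Euler polynomials and alternating power sums. -/

theorem eulerNumber_odd : ∀ n : ℕ, Odd n → eulerNumber n = 0 := by
  intro n
  induction n using Nat.strong_induction_on with
  | _ n ih =>
    intro hn
    have h := eulerNumber_recursion n hn.pos
    rw [Finset.sum_eq_single 0] at h
    · simpa using h
    · intro k hk hk0
      simp only [Finset.mem_filter, Finset.mem_range] at hk
      rw [ih (n - k) (by omega) (by
        obtain ⟨a, rfl⟩ := hn
        obtain ⟨b, rfl⟩ := hk.2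
        exact ⟨a - b, by omega⟩), mul_zero]
    · intro h0; simp at h0

/-- The Euler polynomial of degree `m`, rescaled to have integer coefficients:
its value at `x` is `2 ^ m E_m((x + 1) / 2)`. -/
def scaledEulerPoly (m : ℕ) (x : ℤ) : ℤ :=
  ∑ k ∈ Finset.range (m + 1), (m.choose k : ℤ) * eulerNumber k * x ^ (m - k)

theorem add_one_pow_add_sub_one_pow (r : ℕ) (x : ℤ) :
    (x + 1) ^ r + (x - 1) ^ r
      = 2 * ∑ i ∈ Finset.range (r + 1), if 2 ∣ i then (r.choose i : ℤ) * x ^ (r - i) else 0 := by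
  rw [sub_eq_add_neg, add_comm x 1, add_comm x (-1), add_pow, add_pow, ← Finset.sum_add_distrib,
    Finset.mul_sum]
  refine Finset.sum_congr rfl fun i _ => ?_
  split_ifs with h
  · rw [Even.neg_one_pow (even_iff_two_dvd.2 h)]; ring
  · rw [Odd.neg_one_pow (Nat.not_even_iff_odd.1 fun h' => h (even_iff_two_dvd.1 h'))]; ring

theorem scaledEulerPoly_add (m : ℕ) (x : ℤ) :
    scaledEulerPoly m (x + 1) + scaledEulerPoly m (x - 1) = 2 * x ^ m := by
  have h1 : scaledEulerPoly m (x + 1) + scaledEulerPoly m (x - 1)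
      = 2 * ∑ k ∈ Finset.range (m + 1), ∑ i ∈ Finset.range (m + 1 - k),
        (if 2 ∣ i then (m.choose k : ℤ) * ((m - k).choose i) * eulerNumber k * x ^ (m - (k + i))
          else 0) := by
    rw [scaledEulerPoly, scaledEulerPoly, ← Finset.sum_add_distrib, Finset.mul_sum]
    refine Finset.sum_congr rfl fun k hk => ?_
    rw [← mul_add, add_one_pow_add_sub_one_pow, mul_left_comm, Finset.mul_sum,
      Nat.sub_add_comm (by simpa [Nat.lt_succ_iff] using hk)]
    congr 1
    refine Finset.sum_congr rfl fun i _ => ?_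
    split_ifs
    · rw [Nat.sub_sub]; ring
    · ring
  rw [h1]
  congr 1
  have h2 := Finset.sum_sigma' (Finset.range (m + 1)) (fun k => Finset.range (m + 1 - k))
    (fun k i => if 2 ∣ i then
      (m.choose k : ℤ) * ((m - k).choose i) * eulerNumber k * x ^ (m - (k + i)) else 0)
  have h3 := Finset.sum_sigma' (Finset.range (m + 1)) (fun s => Finset.range (s + 1))
    (fun s i => if 2 ∣ i then
      (m.choose s : ℤ) * (s.choose i) * eulerNumber (s - i) * x ^ (m - s) else 0)
  -- Grouping by s = k + i makes the inner sum the defining recursion of the Euler numbers, so only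
  -- s = 0 survives.
  have h4 : ∑ s ∈ Finset.range (m + 1), ∑ i ∈ Finset.range (s + 1), (if 2 ∣ i then
      (m.choose s : ℤ) * (s.choose i) * eulerNumber (s - i) * x ^ (m - s) else 0) = x ^ m := by
    rw [Finset.sum_eq_single 0]
    · simp [eulerNumber_zero]
    · intro s _ hs
      have := eulerNumber_recursion s (by omega)
      rw [Finset.sum_filter] at this
      refine Eq.trans ?_ ((congrArg ((m.choose s : ℤ) * x ^ (m - s) * ·) this).trans (mul_zero _))
      simp only [Finset.mul_sum]
      refine Finset.sum_congr rfl fun i _ => ?_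
      split_ifs <;> ring
    · simp
  rw [← h4, h2, h3]
  refine Finset.sum_bij' (fun y _ => ⟨y.1 + y.2, y.2⟩) (fun y _ => ⟨y.1 - y.2, y.2⟩) ?_ ?_ ?_ ?_ ?_
  · rintro ⟨k, i⟩ h; simp only [Finset.mem_sigma, Finset.mem_range] at h ⊢; omega
  · rintro ⟨k, i⟩ h; simp only [Finset.mem_sigma, Finset.mem_range] at h ⊢; omega
  · rintro ⟨k, i⟩ h; simp
  · rintro ⟨k, i⟩ h
    simp only [Finset.mem_sigma, Finset.mem_range] at h ⊢
    rw [Nat.sub_add_cancel (by omega)]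
  · rintro ⟨k, i⟩ h
    simp only [Finset.mem_sigma, Finset.mem_range] at h ⊢
    split_ifs
    · have h5 := Nat.choose_mul (n := m) (k := k + i) (s := k) (by omega)
      rw [Nat.add_sub_cancel_left] at h5
      rw [Nat.add_sub_cancel, ← Nat.choose_symm_add (a := k) (b := i)]
      have h6 : (m.choose (k + i) : ℤ) * ((k + i).choose k) = m.choose k * ((m - k).choose i) := by
        exact_mod_cast h5
      rw [h6]
    · rfl

theorem scaledEulerPoly_neg {m : ℕ} (hm : Even m) (x : ℤ) :
    scaledEulerPoly m (-x) = scaledEulerPoly m x := by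
  refine Finset.sum_congr rfl fun k hk => ?_
  rcases Nat.even_or_odd k with h | h
  · have hk' : k ≤ m := Nat.lt_succ_iff.1 (Finset.mem_range.1 hk)
    rw [Even.neg_pow ((Nat.even_sub hk').2 (iff_of_true hm h))]
  · rw [eulerNumber_odd k h]; simp

theorem scaledEulerPoly_one {m : ℕ} (hm : Even m) (h0 : m ≠ 0) : scaledEulerPoly m 1 = 0 := by
  have h := scaledEulerPoly_add m 0
  rw [zero_add, zero_sub, scaledEulerPoly_neg hm, zero_pow h0] at h
  omega

theorem scaledEulerPoly_zero (m : ℕ) : scaledEulerPoly m 0 = eulerNumber m := by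
  rw [scaledEulerPoly, Finset.sum_range_succ, Finset.sum_eq_zero]
  · simp
  · intro k hk
    rw [zero_pow (by have := Finset.mem_range.1 hk; omega), mul_zero]

theorem dvd_scaledEulerPoly_sub (m : ℕ) (x : ℤ) : x ∣ scaledEulerPoly m x - eulerNumber m := by
  rw [← scaledEulerPoly_zero, scaledEulerPoly, scaledEulerPoly, ← Finset.sum_sub_distrib]
  refine Finset.dvd_sum fun k _ => ?_
  rw [← mul_sub]
  exact Dvd.dvd.mul_left (by simpa using sub_dvd_pow_sub_pow x 0 (m - k)) _

/-- `scaledEulerPoly_add` at the even points 2(j+1) telescopes; the initial term is the zero of the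
polynomial at 1. -/
theorem two_mul_sum_alternating_pow {m : ℕ} (hm : Even m) (h0 : m ≠ 0) (n : ℕ) :
    2 * ∑ j ∈ Finset.range n, (-1 : ℤ) ^ (j + 1) * (2 * ((j : ℤ) + 1)) ^ m
      = (-1) ^ n * scaledEulerPoly m (2 * n + 1) := by
  induction n with
  | zero => simp [scaledEulerPoly_one hm h0]
  | succ n ih =>
    rw [Finset.sum_range_succ, mul_add, ih]
    have h := scaledEulerPoly_add m (2 * (n + 1))
    rw [show (2 * ((n : ℤ) + 1) - 1) = 2 * n + 1 by ring] at h
    push_cast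
    rw [pow_succ]
    linear_combination (-1 : ℤ) ^ n * h

/-! ### Rationals integral at p and their congruences. -/

/-- The ring of rational numbers with denominator prime to `m`. -/
def coprimeDenSubring (m : ℕ) : Subring ℚ where
  carrier := {x | x.den.Coprime m}
  mul_mem' {x y} hx hy := Nat.Coprime.coprime_dvd_left (Rat.mul_den_dvd x y) (Nat.Coprime.mul_left hx hy)
  one_mem' := by simp
  add_mem' {x y} hx hy := Nat.Coprime.coprime_dvd_left (Rat.add_den_dvd x y) (Nat.Coprime.mul_left hx hy)
  zero_mem' := by simp
  neg_mem' {x} hx := by simpa using hx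

theorem mem_coprimeDenSubring {m : ℕ} {x : ℚ} : x ∈ coprimeDenSubring m ↔ x.den.Coprime m := Iff.rfl

theorem coprimeDenSubring_pow (m : ℕ) {e : ℕ} (he : e ≠ 0) :
    coprimeDenSubring (m ^ e) = coprimeDenSubring m := by
  ext x
  rw [mem_coprimeDenSubring, mem_coprimeDenSubring, Nat.coprime_pow_right_iff (Nat.pos_of_ne_zero he)]

theorem inv_natCast_mem_coprimeDenSubring {m j : ℕ} (h : j.Coprime m) :
    ((j : ℚ))⁻¹ ∈ coprimeDenSubring m := by
  rw [mem_coprimeDenSubring, Rat.inv_natCast_den]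
  split_ifs
  · simp
  · exact h

/-- Congruence of rational numbers modulo `a` in the ring of rationals with denominator prime
to `p`. -/
def CongrMod (p : ℕ) (a x y : ℚ) : Prop := ∃ z ∈ coprimeDenSubring p, x - y = a * z

namespace CongrMod

variable {p : ℕ} {a b x y z w : ℚ}

theorem of_eq (h : x = y) : CongrMod p a x y := ⟨0, zero_mem _, by rw [h]; ring⟩

theorem trans : CongrMod p a x y → CongrMod p a y z → CongrMod p a x z := by
  rintro ⟨u, hu, h⟩ ⟨v, hv, h'⟩
  exact ⟨u + v, add_mem hu hv, by linear_combination h + h'⟩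

theorem add : CongrMod p a x y → CongrMod p a z w → CongrMod p a (x + z) (y + w) := by
  rintro ⟨u, hu, h⟩ ⟨v, hv, h'⟩
  exact ⟨u + v, add_mem hu hv, by linear_combination h + h'⟩

theorem mul_left (hz : z ∈ coprimeDenSubring p) : CongrMod p a x y → CongrMod p a (z * x) (z * y) := by
  rintro ⟨u, hu, h⟩
  exact ⟨z * u, mul_mem hz hu, by linear_combination z * h⟩

theorem mul_right (hz : z ∈ coprimeDenSubring p) (h : CongrMod p a x y) :
    CongrMod p a (x * z) (y * z) := by
  rw [mul_comm x, mul_comm y]; exact h.mul_left hz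

theorem scale (c : ℚ) : CongrMod p a x y → CongrMod p (c * a) (c * x) (c * y) := by
  rintro ⟨u, hu, h⟩
  exact ⟨u, hu, by linear_combination c * h⟩

theorem of_mul (hb : b ∈ coprimeDenSubring p) : CongrMod p (a * b) x y → CongrMod p a x y := by
  rintro ⟨u, hu, h⟩
  exact ⟨b * u, mul_mem hb hu, by linear_combination h⟩

theorem sum {ι : Type*} (s : Finset ι) (f g : ι → ℚ) (h : ∀ i ∈ s, CongrMod p a (f i) (g i)) :
    CongrMod p a (∑ i ∈ s, f i) (∑ i ∈ s, g i) := by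
  choose! u hu hf using h
  exact ⟨∑ i ∈ s, u i, sum_mem hu, by
    rw [← Finset.sum_sub_distrib, Finset.mul_sum]; exact Finset.sum_congr rfl hf⟩

theorem of_dvd {i j k : ℤ} (h : k ∣ i - j) : CongrMod p (k : ℚ) i j := by
  obtain ⟨c, hc⟩ := h
  exact ⟨c, intCast_mem _ c, by exact_mod_cast hc⟩

theorem ratModEq {e : ℕ} (he : e ≠ 0) (hx : x ∈ coprimeDenSubring p) (hy : y ∈ coprimeDenSubring p)
    (h : CongrMod p ((p : ℚ) ^ e) x y) : RatModEq (p ^ e) x y := by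
  obtain ⟨z, hz, h⟩ := h
  rw [← coprimeDenSubring_pow p he] at hx hy hz
  exact ⟨hx, hy, z, hz, by push_cast; exact h⟩

end CongrMod

theorem inv_mem_of_lt {p j : ℕ} (hp : p.Prime) (h0 : 0 < j) (h : j < p) :
    ((j : ℚ))⁻¹ ∈ coprimeDenSubring p :=
  inv_natCast_mem_coprimeDenSubring (Nat.coprime_of_lt_prime h0.ne' h hp).symm

theorem inv_succ_mem {p j : ℕ} (hp : p.Prime) (h : j + 1 < p) :
    ((j : ℚ) + 1)⁻¹ ∈ coprimeDenSubring p := by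
  exact_mod_cast inv_mem_of_lt hp j.succ_pos h

theorem harmonic_mem {p k : ℕ} (hp : p.Prime) (h : k < p) : harmonic k ∈ coprimeDenSubring p :=
  sum_mem fun i hi => inv_mem_of_lt hp i.succ_pos (by have := Finset.mem_range.1 hi; omega)

theorem harmonicSecond_mem {p k : ℕ} (hp : p.Prime) (h : k < p) :
    harmonicSecond k ∈ coprimeDenSubring p :=
  sum_mem fun i hi => by
    rw [Finset.mem_Icc] at hi
    rw [one_div, ← inv_pow]
    exact pow_mem (inv_mem_of_lt hp hi.1 (by omega)) _

theorem legendreCoeff_mem (p n k : ℕ) : legendreCoeff n k ∈ coprimeDenSubring p :=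
  mul_mem (mul_mem (pow_mem (neg_mem (one_mem _)) _) (natCast_mem _ _)) (natCast_mem _ _)

theorem inv_two_mem {p : ℕ} (hp : p.Prime) (h : 3 < p) : (2 : ℚ)⁻¹ ∈ coprimeDenSubring p := by
  exact_mod_cast inv_mem_of_lt hp two_pos (by omega)

/-! ### Squared central binomial coefficients modulo p². -/

/-- The square of the coefficient of `x ^ k` in `(1 - x) ^ (-1/2)`. -/
def centralTerm (k : ℕ) : ℚ := ((2 * k).choose k : ℚ) ^ 2 / 16 ^ k

theorem centralTerm_mem {p : ℕ} (hp : p.Prime) (h : 3 < p) (k : ℕ) :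
    centralTerm k ∈ coprimeDenSubring p := by
  rw [centralTerm, div_eq_mul_inv, show (16 : ℚ) = 2 ^ 4 by norm_num, ← pow_mul, ← inv_pow]
  exact mul_mem (pow_mem (natCast_mem _ _) _) (pow_mem (inv_two_mem hp h) _)

theorem centralTerm_succ (k : ℕ) :
    ((k : ℚ) + 1) ^ 2 * centralTerm (k + 1) = (k + 1 / 2) ^ 2 * centralTerm k := by
  have h := congrArg (Nat.cast : ℕ → ℚ) (Nat.succ_mul_centralBinom_succ k)
  simp only [Nat.centralBinom_eq_two_mul_choose] at h
  push_cast at h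
  rw [centralTerm, centralTerm, pow_succ]
  field_simp
  have h2 := congrArg (· ^ 2) h
  linear_combination 4 * 16 ^ k * h2

theorem legendreCoeff_congrMod_centralTerm {p n : ℕ} (hp : p.Prime) (h : 3 < p) (hn : p = 2 * n + 1)
    {k : ℕ} (hk : k ≤ n) : CongrMod p ((p : ℚ) ^ 2) (centralTerm k) (legendreCoeff n k) := by
  induction k with
  | zero => exact CongrMod.of_eq (by simp [centralTerm, legendreCoeff])
  | succ k ih =>
    obtain ⟨u, hu, h1⟩ := ih (by omega)
    have h0 : (k : ℚ) + 1 ≠ 0 := by positivity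
    have hi := inv_succ_mem (j := k) hp (by omega)
    have h2 := inv_two_mem hp h
    have h3 := centralTerm_succ k
    have h4 := legendreCoeff_succ_right n k
    have hn' : (p : ℚ) = 2 * n + 1 := by exact_mod_cast hn
    -- Subtracting the two recurrences, the error at k+1 times (k+1)² is (k+1/2)² times the error at
    -- k plus (p²/4) L(n,k).
    refine ⟨((k : ℚ) + 1)⁻¹ ^ 2 * ((k + 2⁻¹) ^ 2 * u + 2⁻¹ ^ 2 * legendreCoeff n k), ?_, ?_⟩
    · exact mul_mem (pow_mem hi _) (add_mem (mul_mem (pow_mem (add_mem (natCast_mem _ _) h2) _) hu)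
        (mul_mem (pow_mem h2 _) (legendreCoeff_mem _ _ _)))
    · rw [hn'] at h1 ⊢
      field_simp
      linear_combination 4 * h3 - 4 * h4 + (2 * (k : ℚ) + 1) ^ 2 * h1

/-! ### Alternating harmonic sums modulo p and p². -/

theorem inv_sq_congrMod_pow {p j : ℕ} (hp : p.Prime) (h3 : 3 < p) (h0 : 0 < j) (h : j < p) :
    CongrMod p p (((j : ℚ))⁻¹ ^ 2) ((j : ℚ) ^ (p - 3)) := by
  have hc : IsCoprime (j : ℤ) p :=
    Nat.isCoprime_iff_coprime.2 (Nat.coprime_of_lt_prime h0.ne' h hp).symm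
  obtain ⟨c, hc⟩ := (Int.ModEq.pow_card_sub_one_eq_one hp hc).symm.dvd
  have hc' : (j : ℚ) ^ (p - 1) - 1 = p * c := by exact_mod_cast hc
  rw [show p - 1 = (p - 3) + 2 by omega, pow_add] at hc'
  have hj : (j : ℚ) ≠ 0 := by positivity
  refine ⟨-(((j : ℚ))⁻¹ ^ 2 * c), neg_mem (mul_mem (pow_mem (inv_mem_of_lt hp h0 h) _)
    (intCast_mem _ c)), ?_⟩
  field_simp
  linear_combination -hc'

theorem alternatingHarmonic_two_congrMod {p n : ℕ} (hp : p.Prime) (h3 : 3 < p) (hn : p = 2 * n + 1) :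
    CongrMod p p (alternatingHarmonic 2 n) (2 * (-1) ^ n * eulerNumber (p - 3)) := by
  -- Writing 1/k² = 4/(2k)² moves to even bases, so that the telescoped sum ends at 2n+1 = p, where
  -- the Euler polynomial is congruent to its value at 0.
  have h1 : alternatingHarmonic 2 n
      = 4 * ∑ j ∈ Finset.range n, (-1) ^ (j + 1) * (((2 * (j + 1) : ℕ) : ℚ))⁻¹ ^ 2 := by
    rw [alternatingHarmonic, Finset.mul_sum]
    refine Finset.sum_congr rfl fun j _ => ?_
    push_cast
    field_simp
    ring
  have h2 : CongrMod p p (alternatingHarmonic 2 n)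
      (4 * ∑ j ∈ Finset.range n, (-1) ^ (j + 1) * ((2 * (j + 1) : ℕ) : ℚ) ^ (p - 3)) := by
    rw [h1]
    refine CongrMod.mul_left (by exact_mod_cast natCast_mem (coprimeDenSubring p) 4) (CongrMod.sum _ _ _ fun j hj => ?_)
    have := Finset.mem_range.1 hj
    exact (inv_sq_congrMod_pow hp h3 (by omega) (by omega)).mul_left
      (pow_mem (neg_mem (one_mem _)) _)
  have h4 := two_mul_sum_alternating_pow (m := p - 3) ⟨n - 1, by omega⟩ (by omega) n
  have h5 : (4 * ∑ j ∈ Finset.range n, (-1) ^ (j + 1) * ((2 * (j + 1) : ℕ) : ℚ) ^ (p - 3))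
      = 2 * (-1) ^ n * (scaledEulerPoly (p - 3) p : ℤ) := by
    have h6 := congrArg (Int.cast : ℤ → ℚ) h4
    rw [show (2 * (n : ℤ) + 1) = p by rw [hn]; push_cast; rfl] at h6
    push_cast at h6 ⊢
    linear_combination 2 * h6
  rw [h5] at h2
  refine h2.trans (CongrMod.mul_left (mul_mem (by exact_mod_cast natCast_mem (coprimeDenSubring p) 2)
    (pow_mem (neg_mem (one_mem _)) _)) ?_)
  exact_mod_cast CongrMod.of_dvd (dvd_scaledEulerPoly_sub (p - 3) p)

theorem dvd_sum_range_pow {p m : ℕ} (hp : p.Prime) (hm : m < p - 1) :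
    p ∣ ∑ j ∈ Finset.range p, j ^ m := by
  have := Fact.mk hp
  rw [← ZMod.natCast_eq_zero_iff]
  push_cast
  rw [← FiniteField.sum_pow_lt_card_sub_one (ZMod p) m (by rwa [ZMod.card])]
  refine Finset.sum_bij' (fun j _ => (j : ZMod p)) (fun x _ => x.val) ?_ ?_ ?_ ?_ ?_
  · simp
  · intro x _; simpa using x.val_lt
  · intro j hj; exact ZMod.val_cast_of_lt (Finset.mem_range.1 hj)
  · simp
  · simp

theorem sum_inv_sq_congrMod_zero {p : ℕ} (hp : p.Prime) (h3 : 3 < p) :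
    CongrMod p p (∑ j ∈ Finset.range (p - 1), ((j : ℚ) + 1)⁻¹ ^ 2) 0 := by
  have h1 : CongrMod p p (∑ j ∈ Finset.range (p - 1), ((j : ℚ) + 1)⁻¹ ^ 2)
      (∑ j ∈ Finset.range (p - 1), ((j : ℚ) + 1) ^ (p - 3)) := by
    refine CongrMod.sum _ _ _ fun j hj => ?_
    have := Finset.mem_range.1 hj
    exact_mod_cast inv_sq_congrMod_pow hp h3 j.succ_pos (by omega)
  refine h1.trans ?_
  obtain ⟨c, hc⟩ := dvd_sum_range_pow hp (show p - 3 < p - 1 by omega)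
  rw [show p = p - 1 + 1 by omega, Finset.sum_range_succ', ← show p = p - 1 + 1 by omega,
    zero_pow (by omega), add_zero] at hc
  exact ⟨c, natCast_mem _ c, by rw [sub_zero]; exact_mod_cast hc⟩

/-- **Wolstenholme's theorem** for harmonic numbers. -/
theorem harmonic_prime_sub_one_congrMod_zero {p : ℕ} (hp : p.Prime) (h3 : 3 < p) :
    CongrMod p ((p : ℚ) ^ 2) (harmonic (p - 1)) 0 := by
  -- Pairing j with p - j extracts one factor p; the remaining sum is congruent to -∑ 1/j², which
  -- supplies the second.
  have h1 : 2 * harmonic (p - 1) = p * ∑ j ∈ Finset.range (p - 1),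
      ((j : ℚ) + 1)⁻¹ * ((p : ℚ) - (j + 1))⁻¹ := by
    rw [two_mul]
    nth_rewrite 2 [harmonic]
    rw [← Finset.sum_range_reflect, harmonic, ← Finset.sum_add_distrib, Finset.mul_sum]
    refine Finset.sum_congr rfl fun j hj => ?_
    have hj := Finset.mem_range.1 hj
    rw [show p - 1 - 1 - j + 1 = p - (j + 1) by omega, Nat.cast_sub (by omega)]
    have : (p : ℚ) - (j + 1) ≠ 0 := by
      rw [sub_ne_zero]; exact_mod_cast (show p ≠ j + 1 by omega)
    push_cast
    field_simp
    ring
  have h2 : CongrMod p p (∑ j ∈ Finset.range (p - 1), ((j : ℚ) + 1)⁻¹ * ((p : ℚ) - (j + 1))⁻¹)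
      (∑ j ∈ Finset.range (p - 1), (-1) * ((j : ℚ) + 1)⁻¹ ^ 2) := by
    refine CongrMod.sum _ _ _ fun j hj => ?_
    have hj := Finset.mem_range.1 hj
    have h0 : (p : ℚ) - (j + 1) ≠ 0 := by
      rw [sub_ne_zero]; exact_mod_cast (show p ≠ j + 1 by omega)
    refine ⟨((j : ℚ) + 1)⁻¹ ^ 2 * ((p : ℚ) - (j + 1))⁻¹,
      mul_mem (pow_mem (inv_succ_mem hp (by omega)) _) ?_, ?_⟩
    · have := inv_mem_of_lt hp (show 0 < p - (j + 1) by omega) (by omega)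
      rw [Nat.cast_sub (by omega)] at this
      exact_mod_cast this
    · field_simp
      ring
  rw [← Finset.mul_sum] at h2
  have h4 := ((h2.trans ((sum_inv_sq_congrMod_zero hp h3).mul_left
    (neg_mem (one_mem _)))).scale (p : ℚ)).mul_left (inv_two_mem hp h3)
  rw [← h1, ← sq] at h4
  simpa using h4

theorem alternatingHarmonic_one_two_mul (n : ℕ) :
    alternatingHarmonic 1 (2 * n) = harmonic n - harmonic (2 * n) := by
  induction n with
  | zero => simp [alternatingHarmonic]
  | succ n ih =>
    rw [show 2 * (n + 1) = 2 * n + 1 + 1 by ring, alternatingHarmonic_succ, alternatingHarmonic_succ,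
      ih, harmonic_succ, harmonic_succ, harmonic_succ,
      Odd.neg_one_pow ⟨n, rfl⟩,
      Even.neg_one_pow (n := 2 * n + 1 + 1) ⟨n + 1, by ring⟩]
    push_cast
    rw [show 2 * (n : ℚ) + 1 + 1 = 2 * (n + 1) by ring]
    field_simp
    ring

/-- The upper half is reflected by j ↦ p - j, which flips the sign as p is odd, and -1/(p-j) ≡ 1/j +
p/j² modulo p². -/
theorem alternatingHarmonic_one_two_mul_congrMod {p n : ℕ} (hp : p.Prime) (hn : p = 2 * n + 1) :
    CongrMod p ((p : ℚ) ^ 2) (alternatingHarmonic 1 (2 * n))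
      (2 * alternatingHarmonic 1 n + p * alternatingHarmonic 2 n) := by
  have h1 : alternatingHarmonic 1 (2 * n) = alternatingHarmonic 1 n
      + ∑ j ∈ Finset.range n, (-1) ^ (j + 1) * -((p : ℚ) - (j + 1))⁻¹ := by
    rw [alternatingHarmonic, two_mul, Finset.sum_range_add, alternatingHarmonic]
    congr 1
    rw [← Finset.sum_range_reflect]
    refine Finset.sum_congr rfl fun j hj => ?_
    have hj := Finset.mem_range.1 hj
    rw [← Nat.cast_add_one, show n + (n - 1 - j) + 1 = p - (j + 1) by omega,
      Nat.cast_sub (by omega)]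
    have h2 : (-1 : ℚ) ^ (p - (j + 1)) = -(-1) ^ (j + 1) := by
      have h3 : (-1 : ℚ) ^ (p - (j + 1)) * (-1) ^ (j + 1) = -1 := by
        rw [← pow_add, Nat.sub_add_cancel (by omega), hn, pow_succ, pow_mul]; simp
      linear_combination (-1 : ℚ) ^ (j + 1) * h3
        - (-1 : ℚ) ^ (p - (j + 1)) * neg_one_pow_mul_self (j + 1)
    rw [h2]; push_cast; rw [pow_one]; ring
  have h2 : 2 * alternatingHarmonic 1 n + p * alternatingHarmonic 2 n = alternatingHarmonic 1 n
      + ∑ j ∈ Finset.range n, (-1) ^ (j + 1) * (((j : ℚ) + 1)⁻¹ + p * ((j : ℚ) + 1)⁻¹ ^ 2) := by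
    rw [two_mul, add_assoc]
    congr 1
    rw [alternatingHarmonic, alternatingHarmonic, Finset.mul_sum, ← Finset.sum_add_distrib]
    refine Finset.sum_congr rfl fun j _ => ?_
    field_simp
  rw [h1, h2]
  refine (CongrMod.of_eq rfl).add (CongrMod.sum _ _ _ fun j hj => CongrMod.mul_left
    (pow_mem (neg_mem (one_mem _)) _) ?_)
  have hj := Finset.mem_range.1 hj
  have h0 : (p : ℚ) - (j + 1) ≠ 0 := by
    rw [sub_ne_zero]; exact_mod_cast (show p ≠ j + 1 by omega)
  refine ⟨-(((j : ℚ) + 1)⁻¹ ^ 2 * ((p : ℚ) - (j + 1))⁻¹),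
    neg_mem (mul_mem (pow_mem (inv_succ_mem hp (by omega)) _) ?_), ?_⟩
  · have := inv_mem_of_lt hp (show 0 < p - (j + 1) by omega) (by omega)
    rw [Nat.cast_sub (by omega)] at this
    exact_mod_cast this
  · field_simp
    ring

theorem alternatingHarmonic_one_congrMod {p n : ℕ} (hp : p.Prime) (h3 : 3 < p) (hn : p = 2 * n + 1) :
    CongrMod p ((p : ℚ) ^ 2) (alternatingHarmonic 1 n)
      (1 / 2 * harmonic n - (-1) ^ n * (p * eulerNumber (p - 3))) := by
  obtain ⟨u, hu, h1⟩ := alternatingHarmonic_one_two_mul_congrMod hp hn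
  obtain ⟨v, hv, h2⟩ := alternatingHarmonic_two_congrMod hp h3 hn
  obtain ⟨w, hw, h4⟩ := harmonic_prime_sub_one_congrMod_zero hp h3
  rw [show p - 1 = 2 * n by omega] at h4
  rw [alternatingHarmonic_one_two_mul] at h1
  refine ⟨2⁻¹ * (-(u + v + w)), mul_mem (inv_two_mem hp h3)
    (neg_mem (add_mem (add_mem hu hv) hw)), ?_⟩
  linear_combination (-1 / 2 : ℚ) * h1 - (p / 2 : ℚ) * h2 - (1 / 2 : ℚ) * h4

/-! ### Assembly of the four congruences. -/

theorem sum_centralTerm_congrMod {p n : ℕ} (hp : p.Prime) (h3 : 3 < p) (hn : p = 2 * n + 1)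
    (f : ℕ → ℚ) (hf : ∀ k ≤ n, f k ∈ coprimeDenSubring p) :
    CongrMod p ((p : ℚ) ^ 2) (∑ k ∈ Finset.range (n + 1), centralTerm k * f k) (legendreSum n f) := by
  refine CongrMod.sum _ _ _ fun k hk => ?_
  have hk := Nat.lt_succ_iff.1 (Finset.mem_range.1 hk)
  exact (legendreCoeff_congrMod_centralTerm hp h3 hn hk).mul_right (hf k hk)

theorem sum_Icc_zero_eq_sum_centralTerm (n : ℕ) (f : ℕ → ℚ) :
    ∑ k ∈ Finset.Icc 0 n, ((2 * k).choose k : ℚ) ^ 2 * (f k / (16 : ℚ) ^ k)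
      = ∑ k ∈ Finset.range (n + 1), centralTerm k * f k := by
  rw [Finset.range_eq_Ico, Finset.Ico_add_one_right_eq_Icc]
  exact Finset.sum_congr rfl fun k _ => by rw [centralTerm]; ring

theorem sum_Icc_one_eq_sum_centralTerm (n : ℕ) (f : ℕ → ℚ) (hf : f 0 = 0) :
    ∑ k ∈ Finset.Icc 1 n, ((2 * k).choose k : ℚ) ^ 2 * (f k / (16 : ℚ) ^ k)
      = ∑ k ∈ Finset.range (n + 1), centralTerm k * f k := by
  rw [← sum_Icc_zero_eq_sum_centralTerm]
  refine Finset.sum_subset (Finset.Icc_subset_Icc_left zero_le_one) fun k hk hk' => ?_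
  have : k = 0 := by simp only [Finset.mem_Icc] at hk hk'; omega
  rw [this, hf]; simp

theorem sum_centralTerm_mem {p : ℕ} (hp : p.Prime) (h3 : 3 < p) (n : ℕ)
    (f : ℕ → ℚ) (hf : ∀ k ≤ n, f k ∈ coprimeDenSubring p) :
    ∑ k ∈ Finset.range (n + 1), centralTerm k * f k ∈ coprimeDenSubring p :=
  sum_mem fun k hk => mul_mem (centralTerm_mem hp h3 k)
    (hf k (Nat.lt_succ_iff.1 (Finset.mem_range.1 hk)))

theorem legendreSym_neg_one_eq_pow {p n : ℕ} [Fact p.Prime] (hn : p = 2 * n + 1) :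
    (legendreSym p (-1) : ℚ) = (-1) ^ n := by
  rw [legendreSym.at_neg_one (by omega), ZMod.χ₄_eq_neg_one_pow (by omega),
    show p / 2 = n by omega]
  push_cast; rfl

theorem theorem4p1 (p : ℕ) [Fact p.Prime] (hp : 3 < p) :
    RatModEq (p ^ 2)
      (∑ k ∈ Finset.Icc 0 ((p - 1) / 2),
        ((2 * k).choose k : ℚ) ^ 2 * (harmonic k / (16 : ℚ) ^ k))
      (2 * (legendreSym p (-1) : ℚ) * harmonic ((p - 1) / 2)) ∧
    RatModEq p
      (∑ k ∈ Finset.Icc 1 ((p - 1) / 2),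
        ((2 * k).choose k : ℚ) ^ 2 * (harmonicSecond k / (16 : ℚ) ^ k))
      (-4 * (eulerNumber (p - 3) : ℚ)) ∧
    RatModEq p
      (∑ k ∈ Finset.Icc 1 ((p - 1) / 2),
        ((2 * k).choose k : ℚ) ^ 2 * (harmonic k / ((k : ℚ) * (16 : ℚ) ^ k)))
      (4 * (legendreSym p (-1) : ℚ) * (eulerNumber (p - 3) : ℚ)) ∧
    RatModEq (p ^ 2)
      (∑ k ∈ Finset.Icc 0 ((p - 1) / 2),
        ((2 * k).choose k : ℚ) ^ 2 * (harmonic (2 * k) / (16 : ℚ) ^ k))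
      ((legendreSym p (-1) : ℚ) * (3 / 2) * harmonic ((p - 1) / 2)
        + (p : ℚ) * (eulerNumber (p - 3) : ℚ)) := by
  have hpr : p.Prime := Fact.out
  obtain ⟨n, hn⟩ := hpr.odd_of_ne_two (by omega)
  have hpow : ((p : ℚ) ^ 2) = p * p := sq _
  have hpm : (p : ℚ) ∈ coprimeDenSubring p := natCast_mem _ p
  have hm : ∀ z : ℤ, (z : ℚ) ∈ coprimeDenSubring p := fun z => intCast_mem _ z
  have hs : ((-1 : ℚ) ^ n) ∈ coprimeDenSubring p := pow_mem (neg_mem (one_mem _)) _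
  have hH : harmonic n ∈ coprimeDenSubring p := harmonic_mem hpr (by omega)
  have hE := hm (eulerNumber (p - 3))
  have hU := alternatingHarmonic_two_congrMod hpr hp hn
  have h1 : ∀ k ≤ n, harmonic k ∈ coprimeDenSubring p := fun k _ => harmonic_mem hpr (by omega)
  have h2 : ∀ k ≤ n, harmonicSecond k ∈ coprimeDenSubring p :=
    fun k _ => harmonicSecond_mem hpr (by omega)
  have h3 : ∀ k ≤ n, harmonic k / k ∈ coprimeDenSubring p := by
    intro k hk
    rcases Nat.eq_zero_or_pos k with rfl | h0
    · simp
    · rw [div_eq_mul_inv]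
      exact mul_mem (h1 k hk) (inv_mem_of_lt hpr h0 (by omega))
  -- Here 2k ≤ 2n = p - 1, so no denominator reaches p.
  have h4 : ∀ k ≤ n, harmonic (2 * k) ∈ coprimeDenSubring p :=
    fun k _ => harmonic_mem hpr (by omega)
  rw [legendreSym_neg_one_eq_pow hn, show (p - 1) / 2 = n by omega]
  refine ⟨?_, ?_, ?_, ?_⟩
  · rw [sum_Icc_zero_eq_sum_centralTerm]
    refine CongrMod.ratModEq two_ne_zero (sum_centralTerm_mem hpr hp n _ h1)
      (mul_mem (mul_mem (mod_cast hm 2) hs) hH) ?_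
    rw [← legendreSum_harmonic]
    exact sum_centralTerm_congrMod hpr hp hn _ h1
  · rw [sum_Icc_one_eq_sum_centralTerm _ _ (by simp [harmonicSecond])]
    nth_rewrite 1 [← pow_one p]
    refine CongrMod.ratModEq one_ne_zero (sum_centralTerm_mem hpr hp n _ h2)
      (mul_mem (mod_cast hm (-4)) hE) ?_
    have h := sum_centralTerm_congrMod hpr hp hn _ h2
    rw [hpow, legendreSum_harmonicSecond] at h
    rw [pow_one]
    refine (h.of_mul hpm).trans ((hU.mul_left (mul_mem (mod_cast hm (-2)) hs)).trans
      (CongrMod.of_eq ?_))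
    linear_combination (-4 * (eulerNumber (p - 3) : ℚ)) * neg_one_pow_mul_self n
  · have hr : ∀ k : ℕ, harmonic k / ((k : ℚ) * (16 : ℚ) ^ k) = harmonic k / k / (16 : ℚ) ^ k :=
      fun k => (div_div _ _ _).symm
    simp only [hr]
    -- The added term k = 0 is 0 / 0 = 0.
    rw [sum_Icc_one_eq_sum_centralTerm _ (fun k => harmonic k / k) (by simp)]
    nth_rewrite 1 [← pow_one p]
    refine CongrMod.ratModEq one_ne_zero (sum_centralTerm_mem hpr hp n _ h3)
      (mul_mem (mul_mem (mod_cast hm 4) hs) hE) ?_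
    have h := sum_centralTerm_congrMod hpr hp hn _ h3
    rw [hpow, legendreSum_harmonic_div] at h
    rw [pow_one]
    refine (h.of_mul hpm).trans ((hU.mul_left (mod_cast hm 2)).trans (CongrMod.of_eq ?_))
    ring
  · rw [sum_Icc_zero_eq_sum_centralTerm _ (fun k => harmonic (2 * k))]
    refine CongrMod.ratModEq two_ne_zero (sum_centralTerm_mem hpr hp n _ h4)
      (add_mem (mul_mem (mul_mem hs ?_) hH) (mul_mem hpm hE)) ?_
    · rw [div_eq_mul_inv]
      exact mul_mem (mod_cast hm 3) (inv_two_mem hpr hp)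
    have h := sum_centralTerm_congrMod hpr hp hn _ h4
    rw [legendreSum_harmonic_two_mul] at h
    obtain ⟨u, hu, hA⟩ := alternatingHarmonic_one_congrMod hpr hp hn
    refine h.trans ⟨-((-1) ^ n * u), neg_mem (mul_mem hs hu), ?_⟩
    linear_combination (-(-1 : ℚ) ^ n) * hA
      + (p * (eulerNumber (p - 3) : ℚ)) * neg_one_pow_mul_self n
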